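/- For a simple connected graph $G$ on $n\ge 2$ vertices, let $\mu_1(G)\ge\mu_2(G)\ge\cdots\ge\mu_n(G)=0$ be the eigenvalues, repeated with multiplicity, of its Laplacian matrix $L(G)=D(G)-A(G)$ (the diagonal matrix of vertex degrees minus the adjacency matrix), and let $$R_L(G)=\frac{\mu_1(G)}{\mu_{n-1}(G)}$$ be its Laplacian spectral ratio. Let $T$ be a tree on $n\ge 6$ vertices with maximum degree $\Delta$ and diameter $\mathcal D$, and let $P_n$ be the path on $n$ vertices. If $$\Delta+2\sqrt{\Delta+1}\le\frac{1600\,n}{121\,\mathcal D\,\pi^2},$$ then $R_L(T)<R_L(P_n)$. -/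

import Mathlib

namespace SimpleGraph

variable {V : Type*} [Fintype V] [DecidableEq V]

/-- The `k`-th largest Laplacian eigenvalue `μ_k(G)` of a graph `G` on `n` vertices, where
`k = 1, …, n` and eigenvalues are repeated according to multiplicity, so that
`μ_1(G) ≥ μ_2(G) ≥ ⋯ ≥ μ_n(G) = 0`. (The value is `0` for `k` outside of this range.) -/
noncomputable def lapEigenvalue (G : SimpleGraph V) [DecidableRel G.Adj] (k : ℕ) : ℝ :=
  if h : 1 ≤ k ∧ k ≤ Fintype.card V then
    (G.isHermitian_lapMatrix ℝ).eigenvalues₀ ⟨k - 1, by omega⟩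
  else 0

/-- The Laplacian spectral ratio `R_L(G) = μ_1(G) / μ_{n-1}(G)` of a graph `G` on `n` vertices:
the quotient of the largest by the second smallest Laplacian eigenvalue. It is meaningful for
connected graphs on at least two vertices. -/
noncomputable def lapSpectralRatio (G : SimpleGraph V) [DecidableRel G.Adj] : ℝ :=
  G.lapEigenvalue 1 / G.lapEigenvalue (Fintype.card V - 1)

end SimpleGraph

open Finset Matrix

namespace SimpleGraph

/-! ### Ordered Laplacian spectrum of a finite graph -/

section Spectrum

variable {V : Type*} [Fintype V] [DecidableEq V] (G : SimpleGraph V) [DecidableRel G.Adj]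

/-! Write `Δ`, `D` for the maximum degree and diameter of the tree. Three estimates combine: `μ_1(T)
≤ Δ + 2√Δ` (`IsTree.lapEigenvalue_one_le`), `μ_{n-1}(T) ≥ 4/(nD)`
(`IsTree.four_le_lapEigenvalue_mul`), and `R_L(P_n) ≥ 400n²/(121π²)`
(`le_lapSpectralRatio_pathGraph`). The first two give `R_L(T) < (Δ + 2√(Δ+1)) nD/4`, which the
hypothesis bounds by `400n²/(121π²)`.

The bound on `μ_1` is a weighted AM-GM on each edge, with weights favouring the edge towards a root.
The bound on `μ_{n-1}` applies Cauchy-Schwarz along tree paths and counts the paths through each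
edge. For the path, explicit cosine eigenvectors and `cos x ≥ 1 - x²/2` suffice. -/

/-- The Laplacian quadratic form. -/
theorem dotProduct_lapMatrix_mulVec (x : V → ℝ) :
    x ⬝ᵥ (G.lapMatrix ℝ *ᵥ x) =
      (∑ i : V, ∑ j : V, if G.Adj i j then (x i - x j) ^ 2 else 0) / 2 := by
  rw [← lapMatrix_toLinearMap₂' ℝ G x, toLinearMap₂'_apply']

theorem lapMatrix_mulVec_eq_sum_ite (x : V → ℝ) (i : V) :
    (G.lapMatrix ℝ *ᵥ x) i = ∑ j : V, if G.Adj i j then x i - x j else 0 := by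
  rw [lapMatrix_mulVec_apply, degree_eq_sum_if_adj, neighborFinset_eq_filter, sum_filter, sum_mul,
    ← sum_sub_distrib]
  refine sum_congr rfl fun j _ => ?_
  split_ifs <;> simp

theorem lapEigenvalue_succ {k : ℕ} (hk : k < Fintype.card V) :
    G.lapEigenvalue (k + 1) = (G.isHermitian_lapMatrix ℝ).eigenvalues₀ ⟨k, hk⟩ := by
  rw [lapEigenvalue, dif_pos ⟨by omega, by omega⟩]
  rfl

theorem lapEigenvalue_antitone {j k : ℕ} (hjk : j ≤ k) (hk : k < Fintype.card V) :
    G.lapEigenvalue (k + 1) ≤ G.lapEigenvalue (j + 1) := by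
  rw [G.lapEigenvalue_succ hk, G.lapEigenvalue_succ (hjk.trans_lt hk)]
  exact (G.isHermitian_lapMatrix ℝ).eigenvalues₀_antitone hjk

/-- An orthonormal family of eigenvectors for the ordered Laplacian eigenvalues. -/
theorem exists_orthonormal_lapEigenvalue :
    ∃ b : Fin (Fintype.card V) → V → ℝ,
      (∀ i j, b i ⬝ᵥ b j = if i = j then 1 else 0) ∧
      ∀ i, G.lapMatrix ℝ *ᵥ b i = G.lapEigenvalue (i + 1) • b i := by
  set hA := G.isHermitian_lapMatrix ℝ
  set e : Fin (Fintype.card V) ≃ V := Fintype.equivOfCardEq (Fintype.card_fin _)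
  refine ⟨fun i => ⇑(hA.eigenvectorBasis (e i)), fun i j => ?_, fun i => ?_⟩
  · have h := orthonormal_iff_ite.mp hA.eigenvectorBasis.orthonormal (e j) (e i)
    rw [EuclideanSpace.inner_eq_star_dotProduct] at h
    simpa [e.injective.eq_iff, eq_comm] using h
  · have h := hA.mulVec_eigenvectorBasis (e i)
    rw [h, G.lapEigenvalue_succ i.2]
    simp [IsHermitian.eigenvalues, e]

/-- Every eigenvalue of the Laplacian occurs among the ordered eigenvalues. -/
theorem exists_lapEigenvalue_eq {x : V → ℝ} {c : ℝ} (hx : x ≠ 0)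
    (h : G.lapMatrix ℝ *ᵥ x = c • x) :
    ∃ k < Fintype.card V, G.lapEigenvalue (k + 1) = c := by
  set hA := G.isHermitian_lapMatrix ℝ
  have hc : c ∈ spectrum ℝ (G.lapMatrix ℝ) := by
    rw [← Matrix.spectrum_toLin']
    apply Module.End.HasEigenvalue.mem_spectrum
    refine Module.End.hasEigenvalue_of_hasEigenvector (x := x) ⟨?_, hx⟩
    rw [Module.End.mem_eigenspace_iff, toLin'_apply, h]
  rw [hA.spectrum_real_eq_range_eigenvalues] at hc
  obtain ⟨v, hv⟩ := hc
  refine ⟨_, ((Fintype.equivOfCardEq (Fintype.card_fin _)).symm v).2, ?_⟩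
  rw [lapEigenvalue_succ]
  exact hv

theorem lapEigenvalue_nonneg (k : ℕ) : 0 ≤ G.lapEigenvalue k := by
  rw [lapEigenvalue]
  split_ifs with h
  · have := (posSemidef_lapMatrix ℝ G).eigenvalues_nonneg
      (Fintype.equivOfCardEq (Fintype.card_fin _) ⟨k - 1, by omega⟩)
    simpa [IsHermitian.eigenvalues] using this
  · rfl

variable {G}

theorem lapEigenvalue_card [Nonempty V] : G.lapEigenvalue (Fintype.card V) = 0 := by
  have h1 : (fun _ : V => (1 : ℝ)) ≠ 0 := fun h => one_ne_zero (congrFun h (Classical.arbitrary V))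
  obtain ⟨k, hk, h⟩ := G.exists_lapEigenvalue_eq (c := 0) h1
    (by rw [lapMatrix_mulVec_const_eq_zero, zero_smul])
  have h2 := G.lapEigenvalue_antitone (j := k) (k := Fintype.card V - 1) (by omega) (by omega)
  rw [h, Nat.sub_add_cancel (by omega)] at h2
  exact le_antisymm h2 (G.lapEigenvalue_nonneg _)

theorem Connected.eq_of_lapMatrix_mulVec_eq_zero (hG : G.Connected) {x : V → ℝ}
    (h : G.lapMatrix ℝ *ᵥ x = 0) (u v : V) : x u = x v :=
  (G.lapMatrix_mulVec_eq_zero_iff_forall_reachable.mp h) u v (hG.preconnected u v)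

/-- In a connected graph the second smallest Laplacian eigenvalue has an eigenvector
orthogonal to the constant vectors. -/
theorem Connected.exists_sum_eq_zero_lapEigenvalue (hG : G.Connected) (hV : 2 ≤ Fintype.card V) :
    ∃ x : V → ℝ, x ⬝ᵥ x = 1 ∧ ∑ v, x v = 0 ∧
      G.lapMatrix ℝ *ᵥ x = G.lapEigenvalue (Fintype.card V - 1) • x := by
  have := hG.nonempty
  obtain ⟨b, hb, hL⟩ := G.exists_orthonormal_lapEigenvalue
  let i : Fin (Fintype.card V) := ⟨Fintype.card V - 2, by omega⟩
  let l : Fin (Fintype.card V) := ⟨Fintype.card V - 1, by omega⟩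
  have hil : i ≠ l := by simp only [i, l, ne_eq, Fin.mk.injEq]; omega
  have hl0 : G.lapMatrix ℝ *ᵥ b l = 0 := by
    rw [hL, show (l : ℕ) + 1 = Fintype.card V by simp only [l]; omega, lapEigenvalue_card,
      zero_smul]
  have hc := hG.eq_of_lapMatrix_mulVec_eq_zero hl0
  have hll := hb l l
  have hil' := hb i l
  rw [if_neg hil] at hil'
  rw [if_pos rfl] at hll
  let w := Classical.arbitrary V
  have hbl : b l = fun _ => b l w := funext fun v => hc v w
  have hw : b l w ≠ 0 := by
    intro h0
    rw [hbl, h0] at hll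
    simp [dotProduct] at hll
  refine ⟨b i, by simpa using hb i i, ?_, ?_⟩
  · rw [hbl] at hil'
    simp only [dotProduct, ← sum_mul] at hil'
    exact (mul_eq_zero.mp hil').resolve_right hw
  · have := hL i
    rwa [show (i : ℕ) + 1 = Fintype.card V - 1 by simp only [i]; omega] at this

/-- Otherwise the eigenvector with zero sum would be harmonic, hence constant, hence zero. -/
theorem Connected.lapEigenvalue_card_sub_one_pos (hG : G.Connected) (hV : 2 ≤ Fintype.card V) :
    0 < G.lapEigenvalue (Fintype.card V - 1) := by
  have := hG.nonempty
  obtain ⟨x, hx, hs, hL⟩ := hG.exists_sum_eq_zero_lapEigenvalue hV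
  refine (G.lapEigenvalue_nonneg _).lt_of_ne fun h0 => ?_
  rw [← h0, zero_smul] at hL
  let w := Classical.arbitrary V
  have hc : x = fun _ => x w := funext fun v => hG.eq_of_lapMatrix_mulVec_eq_zero hL v w
  have hxw : x w = 0 := by
    rw [hc] at hs
    simpa using hs
  rw [hc, hxw] at hx
  simp [dotProduct] at hx

end Spectrum

/-! ### Trees: upper bound on the largest eigenvalue -/

section Tree

variable {V : Type*} [Fintype V] [DecidableEq V] {G : SimpleGraph V}

omit [Fintype V] [DecidableEq V] in
/-- The edges of a tree can be oriented so that every vertex has at most one out-neighbour. -/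
theorem IsTree.exists_parent (hG : G.IsTree) :
    ∃ f : V → V, ∀ u v, G.Adj u v → f u = v ∨ f v = u := by
  have := hG.connected.nonempty
  choose p hp hp' using (hG.existsUnique_path · (Classical.arbitrary V))
  refine ⟨fun u => (p u).snd, fun u v huv => ?_⟩
  -- With `p u` the path from `u` to a fixed root, either `v` is its second vertex, or prepending
  -- `v` to it gives the unique path from `v`.
  by_cases hv : v ∈ (p u).support
  · exact Or.inl (hG.isAcyclic.eq_snd_of_adj_start (hp u) huv hv).symm
  · right
    change (p v).snd = u
    rw [← hp' v (.cons huv.symm (p u)) ?_]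
    · simp
    · exact (hp u).cons hv

/-- The largest Laplacian eigenvalue of a tree is at most `Δ + 2√Δ`. -/
theorem IsTree.lapEigenvalue_one_le [DecidableRel G.Adj] (hG : G.IsTree) (hΔ : 1 ≤ G.maxDegree) :
    G.lapEigenvalue 1 ≤ G.maxDegree + 2 * √(G.maxDegree : ℝ) := by
  have := hG.connected.nonempty
  obtain ⟨f, hf⟩ := hG.exists_parent
  obtain ⟨b, hb, hL⟩ := G.exists_orthonormal_lapEigenvalue
  set x := b ⟨0, Fintype.card_pos⟩ with hxdef
  have hx : x ⬝ᵥ x = 1 := by rw [hxdef, hb, if_pos rfl]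
  have hLx : G.lapMatrix ℝ *ᵥ x = G.lapEigenvalue 1 • x := hL ⟨0, Fintype.card_pos⟩
  set c : ℝ := √(G.maxDegree : ℝ) with hc
  have hΔ' : (1 : ℝ) ≤ G.maxDegree := by exact_mod_cast hΔ
  have hc1 : 1 ≤ c := Real.one_le_sqrt.mpr hΔ'
  have hc0 : 0 < c := by linarith
  have hcc : c * c = G.maxDegree := Real.mul_self_sqrt (by linarith)
  -- Weight `√Δ` towards the parent and `1/√Δ` away from it. The product over the two directions of
  -- an edge is at least 1, as AM-GM needs.
  let w : V → V → ℝ := fun u v => if f u = v then c else c⁻¹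
  have hinv : c⁻¹ ≤ c := (inv_le_one_of_one_le₀ hc1).trans hc1
  have hw0 : ∀ u v, 0 < w u v := fun u v => by
    simp only [w]; split_ifs <;> positivity
  have hw : ∀ u v, G.Adj u v → 1 ≤ w u v * w v u := fun u v huv => by
    have hci : c * c⁻¹ = 1 := mul_inv_cancel₀ hc0.ne'
    rcases hf u v huv with h | h <;> simp only [w, h, if_true] <;> split_ifs <;> nlinarith
  have hpair : ∀ u v, G.Adj u v →
      (x u - x v) ^ 2 ≤ (1 + w u v) * x u ^ 2 + (1 + w v u) * x v ^ 2 := fun u v huv => by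
    have h1 := hw u v huv
    have h2 := hw0 u v
    have h3 : 0 ≤ w u v * (w u v * x u ^ 2 + w v u * x v ^ 2 + 2 * (x u * x v)) := by
      nlinarith [sq_nonneg (w u v * x u + x v), mul_nonneg (sub_nonneg.mpr h1) (sq_nonneg (x v))]
    nlinarith [nonneg_of_mul_nonneg_right h3 h2]
  -- Only `v = f u` carries the large weight, so the row sum is at most `Δ(1 + 1/√Δ) + √Δ = Δ +
  -- 2√Δ`.
  have hdeg : ∀ u, (∑ v, if G.Adj u v then 1 + w u v else 0) ≤ G.maxDegree + 2 * c := fun u => by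
    calc (∑ v, if G.Adj u v then 1 + w u v else 0)
        ≤ ∑ v, ((if G.Adj u v then 1 else 0) * (1 + c⁻¹) + if f u = v then c else 0) := by
          refine sum_le_sum fun v _ => ?_
          have := inv_pos.mpr hc0
          simp only [w]
          split_ifs <;> linarith
      _ = G.degree u * (1 + c⁻¹) + c := by
          rw [sum_add_distrib, ← sum_mul, ← degree_eq_sum_if_adj]
          simp
      _ ≤ G.maxDegree * (1 + c⁻¹) + c := by
          have : (G.degree u : ℝ) ≤ G.maxDegree := by exact_mod_cast G.degree_le_maxDegree u
          gcongr
      _ = G.maxDegree + 2 * c := by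
          rw [← hcc]
          field_simp
          ring
  have hquad := G.dotProduct_lapMatrix_mulVec x
  rw [hLx, dotProduct_smul, hx, smul_eq_mul, mul_one] at hquad
  rw [hquad]
  have hsplit : (∑ i, ∑ j, if G.Adj i j then (x i - x j) ^ 2 else 0) ≤
      (∑ i, ∑ j, (if G.Adj i j then 1 + w i j else 0) * x i ^ 2) +
      ∑ i, ∑ j, (if G.Adj j i then 1 + w j i else 0) * x j ^ 2 := by
    rw [← sum_add_distrib]
    refine sum_le_sum fun i _ => ?_
    rw [← sum_add_distrib]
    refine sum_le_sum fun j _ => ?_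
    by_cases h : G.Adj i j
    · rw [if_pos h, if_pos h, if_pos h.symm]
      exact hpair i j h
    · rw [if_neg h, if_neg h, if_neg fun h' => h h'.symm, zero_mul, zero_mul, add_zero]
  rw [sum_comm (f := fun i j => (if G.Adj j i then 1 + w j i else 0) * x j ^ 2)] at hsplit
  have hbound : (∑ i, ∑ j, (if G.Adj i j then 1 + w i j else 0) * x i ^ 2) ≤
      G.maxDegree + 2 * c := by
    calc _ ≤ ∑ i, (G.maxDegree + 2 * c) * x i ^ 2 := by
          refine sum_le_sum fun i _ => ?_
          rw [← sum_mul]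
          exact mul_le_mul_of_nonneg_right (hdeg i) (sq_nonneg _)
      _ = _ := by
          rw [← mul_sum]
          simp only [dotProduct, ← sq] at hx
          rw [hx, mul_one]
  linarith

/-! ### Trees: lower bound on the algebraic connectivity -/

omit [Fintype V] [DecidableEq V] in
/-- The difference of a potential along a walk is bounded by the walk's length times its energy. -/
theorem Walk.sq_sub_le_length_mul_sum (x : V → ℝ) {u v : V} (p : G.Walk u v) :
    (x u - x v) ^ 2 ≤
      p.length * ((p.darts.map Dart.toProd).map fun d => (x d.1 - x d.2) ^ 2).sum := by
  induction p with
  | nil => simp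
  | @cons u v w h p ih =>
    simp only [Walk.darts_cons, List.map_cons, List.sum_cons, Walk.length_cons, Nat.cast_add,
      Nat.cast_one]
    set S := ((p.darts.map Dart.toProd).map fun d => (x d.1 - x d.2) ^ 2).sum
    have hS : 0 ≤ S := List.sum_nonneg (by simp only [List.mem_map]; rintro _ ⟨d, -, rfl⟩; positivity)
    set s := x u - x v
    set t := x v - x w
    rw [show x u - x w = s + t by simp only [s, t]; ring]
    have hk : (0 : ℝ) ≤ p.length := Nat.cast_nonneg _
    rcases hk.eq_or_lt with h0 | h0
    · rw [← h0, zero_mul] at ih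
      have ht : t = 0 := by nlinarith
      rw [ht, ← h0]
      nlinarith
    -- Cauchy-Schwarz: `2st ≤ ks² + S` follows from `(ks - t)² ≥ 0` and `t² ≤ kS` after multiplying
    -- by `k`.
    · have : 0 ≤ (p.length : ℝ) * (p.length * s ^ 2 + S - 2 * (s * t)) := by
        nlinarith [sq_nonneg (p.length * s - t)]
      nlinarith [nonneg_of_mul_nonneg_right this h0]

omit [Fintype V] [DecidableEq V] in
/-- A trail through a dart avoids the edge of that dart before and after. -/
theorem Walk.IsTrail.reachable_deleteEdges {u v : V} {p : G.Walk u v} (hp : p.IsTrail) {d : G.Dart}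
    (hd : d ∈ p.darts) :
    (G.deleteEdges {d.edge}).Reachable d.fst u ∧ (G.deleteEdges {d.edge}).Reachable d.snd v := by
  induction p with
  | nil => simp at hd
  | @cons u v w h p ih =>
    rw [Walk.isTrail_cons] at hp
    rw [Walk.darts_cons, List.mem_cons] at hd
    rcases hd with rfl | hd
    · refine ⟨.refl _, ⟨p.toDeleteEdges _ ?_⟩⟩
      rintro e he rfl
      exact hp.2 he
    · obtain ⟨h1, h2⟩ := ih hp.1 hd
      refine ⟨h1.trans (Adj.reachable ?_), h2⟩
      rw [deleteEdges_adj]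
      refine ⟨h.symm, fun he => hp.2 ?_⟩
      rw [Sym2.eq_swap, Set.mem_singleton_iff.mp he]
      exact List.mem_map_of_mem hd

omit [DecidableEq V] in
-- AM-GM for the two sides of an edge cut; it limits how many ordered pairs of vertices are joined
-- by a path through a given dart.
theorem card_filter_mul_card_filter_not_le (c : V → Prop) [DecidablePred c] :
    (4 * ((#{u | c u} * #{u | ¬ c u} : ℕ) : ℝ)) ≤ (Fintype.card V : ℝ) ^ 2 := by
  have h := card_filter_add_card_filter_not (s := (univ : Finset V)) c
  rw [card_univ] at h
  rw [← h]
  push_cast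
  nlinarith [sq_nonneg ((#{u | c u} : ℝ) - #{u | ¬ c u})]

open Classical in
/-- Mohar's bound: the algebraic connectivity of a tree on `n` vertices with diameter `D` is at
least `4 / (n D)`. -/
theorem IsTree.four_le_lapEigenvalue_mul [DecidableRel G.Adj] (hG : G.IsTree)
    (hV : 2 ≤ Fintype.card V) :
    4 ≤ G.lapEigenvalue (Fintype.card V - 1) * (Fintype.card V * G.diam) := by
  have := hG.connected.nonempty
  obtain ⟨x, hx, hs, hL⟩ := hG.connected.exists_sum_eq_zero_lapEigenvalue hV
  set lam := G.lapEigenvalue (Fintype.card V - 1)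
  have hn0 : (0 : ℝ) < Fintype.card V := by exact_mod_cast Fintype.card_pos
  have hquad := G.dotProduct_lapMatrix_mulVec x
  rw [hL, dotProduct_smul, hx, smul_eq_mul, mul_one] at hquad
  have hpath : ∀ u v, ∃ p : G.Walk u v, p.IsPath ∧ p.length ≤ G.diam := fun u v => by
    obtain ⟨p, hp, hl⟩ := hG.connected.exists_path_of_dist u v
    exact ⟨p, hp, hl.trans_le (dist_le_diam (connected_iff_ediam_ne_top.mp hG.connected))⟩
  choose p hp hlen using hpath
  have hx2 : ∑ u, x u ^ 2 = 1 := by simpa only [dotProduct, ← sq] using hx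
  -- The cross terms vanish because the coordinates of `x` sum to zero.
  have hpairs : ∑ u, ∑ v, (x u - x v) ^ 2 = 2 * Fintype.card V := by
    calc _ = ∑ u, (Fintype.card V * x u ^ 2 - 2 * x u * ∑ v, x v + ∑ v, x v ^ 2) := by
          refine sum_congr rfl fun u _ => ?_
          rw [mul_sum, ← nsmul_eq_mul, ← card_univ, ← sum_const, ← sum_sub_distrib,
            ← sum_add_distrib]
          exact sum_congr rfl fun v _ => by ring
      _ = _ := by
          rw [hs, hx2]
          simp only [mul_zero, sub_zero]
          rw [sum_add_distrib, ← mul_sum, hx2]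
          simp
          ring
  have hsingle : ∀ u v, (x u - x v) ^ 2 ≤ G.diam * ∑ a, ∑ b,
      if (a, b) ∈ (p u v).darts.map Dart.toProd then (x a - x b) ^ 2 else 0 := fun u v => by
    have hnd : ((p u v).darts.map Dart.toProd).Nodup :=
      (List.Nodup.of_map _ (hp u v).isTrail.edges_nodup).map Dart.toProd_injective
    have h := (p u v).sq_sub_le_length_mul_sum x
    rw [← List.sum_toFinset _ hnd] at h
    rw [← Fintype.sum_prod_type' (f := fun a b =>
      if (a, b) ∈ (p u v).darts.map Dart.toProd then (x a - x b) ^ 2 else 0), ← sum_filter]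
    have hset : ({q : V × V | (q.1, q.2) ∈ (p u v).darts.map Dart.toProd} : Finset (V × V)) =
        ((p u v).darts.map Dart.toProd).toFinset := by
      ext q
      simp
    rw [hset]
    refine h.trans (mul_le_mul_of_nonneg_right (by exact_mod_cast hlen u v) ?_)
    exact sum_nonneg fun _ _ => sq_nonneg _
  have hcount : ∀ a b, (∑ u, ∑ v,
      if (a, b) ∈ (p u v).darts.map Dart.toProd then (x a - x b) ^ 2 else 0) ≤
      (Fintype.card V : ℝ) ^ 2 / 4 * if G.Adj a b then (x a - x b) ^ 2 else 0 := fun a b => by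
    by_cases hab : G.Adj a b
    · rw [if_pos hab]
      let c : V → Prop := (G.deleteEdges {s(a, b)}).Reachable a
      have hbridge : ¬ (G.deleteEdges {s(a, b)}).Reachable a b :=
        isBridge_iff.mp (isAcyclic_iff_forall_adj_isBridge.mp hG.isAcyclic hab)
      -- Every edge of a tree is a bridge, so a path using the dart `(a, b)` starts on the side of
      -- `a` and ends on the other.
      have hside : ∀ u v, (a, b) ∈ (p u v).darts.map Dart.toProd → c u ∧ ¬ c v := fun u v h => by
        obtain ⟨d, hd, hdab⟩ := List.mem_map.mp h
        obtain ⟨h1, h2⟩ := (hp u v).isTrail.reachable_deleteEdges hd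
        obtain ⟨⟨a', b'⟩, hadj⟩ := d
        obtain ⟨rfl, rfl⟩ := Prod.mk.inj hdab
        exact ⟨h1, fun h3 => hbridge (h3.trans h2.symm)⟩
      calc _ ≤ ∑ u, ∑ v, (if c u then 1 else 0) * (if ¬ c v then 1 else 0) * (x a - x b) ^ 2 := by
            refine sum_le_sum fun u _ => sum_le_sum fun v _ => ?_
            by_cases h : (a, b) ∈ (p u v).darts.map Dart.toProd
            · simp [h, hside u v h]
            · rw [if_neg h]
              positivity
        _ = ((#{u | c u} * #{u | ¬ c u} : ℕ) : ℝ) * (x a - x b) ^ 2 := by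
            rw [Nat.cast_mul, ← sum_boole, ← sum_boole, sum_mul_sum, sum_mul]
            exact sum_congr rfl fun u _ => (sum_mul _ _ _).symm
        _ ≤ _ := by
            have := card_filter_mul_card_filter_not_le c
            exact mul_le_mul_of_nonneg_right (by linarith) (sq_nonneg _)
    · rw [if_neg hab, mul_zero]
      refine (sum_eq_zero fun u _ => sum_eq_zero fun v _ => if_neg fun h => ?_).le
      obtain ⟨d, -, hdab⟩ := List.mem_map.mp h
      have := d.adj
      rw [hdab] at this
      exact hab this
  -- The factor `2 * lam` is the energy over ordered pairs, where each edge counts twice.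
  have hmain : 2 * (Fintype.card V : ℝ) ≤ G.diam * ((Fintype.card V : ℝ) ^ 2 / 4 * (2 * lam)) := by
    calc 2 * (Fintype.card V : ℝ) = ∑ u, ∑ v, (x u - x v) ^ 2 := hpairs.symm
      _ ≤ ∑ u, ∑ v, G.diam * ∑ a, ∑ b,
          (if (a, b) ∈ (p u v).darts.map Dart.toProd then (x a - x b) ^ 2 else 0) :=
          sum_le_sum fun u _ => sum_le_sum fun v _ => hsingle u v
      _ = G.diam * ∑ a, ∑ b, ∑ u, ∑ v,
          (if (a, b) ∈ (p u v).darts.map Dart.toProd then (x a - x b) ^ 2 else 0) := by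
          simp_rw [← mul_sum]
          have hcomm := sum_comm (s := univ) (t := univ) (f := fun q r : V × V =>
            if (r.1, r.2) ∈ (p q.1 q.2).darts.map Dart.toProd then (x r.1 - x r.2) ^ 2 else 0)
          simp only [Fintype.sum_prod_type] at hcomm
          rw [hcomm]
      _ ≤ G.diam * ∑ a, ∑ b, (Fintype.card V : ℝ) ^ 2 / 4 *
          (if G.Adj a b then (x a - x b) ^ 2 else 0) := by
          refine mul_le_mul_of_nonneg_left ?_ (Nat.cast_nonneg _)
          exact sum_le_sum fun a _ => sum_le_sum fun b _ => hcount a b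
      _ = _ := by
          simp_rw [← mul_sum]
          rw [hquad]
          ring
  nlinarith

end Tree

/-! ### Spectrum of the path -/

section Path

variable {n : ℕ} [DecidableRel (pathGraph n).Adj]

/-- The Laplacian of a path acts on samples of a function with reflecting boundary values as the
second difference operator. -/
theorem lapMatrix_pathGraph_mulVec_apply (g : ℝ → ℝ) (h0 : g (-1) = g 0) (hn : g (n - 1) = g n)
    (i : Fin n) :
    ((pathGraph n).lapMatrix ℝ *ᵥ fun j => g (j : ℕ)) i =
      2 * g (i : ℕ) - g ((i : ℕ) + 1) - g ((i : ℕ) - 1) := by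
  rw [lapMatrix_mulVec_eq_sum_ite]
  have hsplit : ∀ j : Fin n, (if (pathGraph n).Adj i j then g (i : ℕ) - g (j : ℕ) else 0) =
      (if (i : ℕ) + 1 = j then g (i : ℕ) - g (j : ℕ) else 0) +
      (if (j : ℕ) + 1 = i then g (i : ℕ) - g (j : ℕ) else 0) := fun j => by
    by_cases h1 : (i : ℕ) + 1 = j
    · have h2 : ¬ (j : ℕ) + 1 = i := by omega
      simp [pathGraph_adj, h1, h2]
    · simp [pathGraph_adj, h1]
  rw [sum_congr rfl fun j _ => hsplit j, sum_add_distrib]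
  have hup : (∑ j : Fin n, if (i : ℕ) + 1 = j then g (i : ℕ) - g (j : ℕ) else 0) =
      g (i : ℕ) - g ((i : ℕ) + 1) := by
    by_cases hi : (i : ℕ) + 1 < n
    · rw [sum_eq_single ⟨(i : ℕ) + 1, hi⟩]
      · simp
      · intro j _ hj
        exact if_neg fun h => hj (Fin.ext h.symm)
      · simp
    · have hin : (n : ℝ) = (i : ℕ) + 1 := by
        have : n = (i : ℕ) + 1 := by omega
        exact_mod_cast this
      rw [hin, add_sub_cancel_right] at hn
      rw [hn, sub_self]
      exact sum_eq_zero fun j _ => if_neg (by omega)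
  have hdown : (∑ j : Fin n, if (j : ℕ) + 1 = i then g (i : ℕ) - g (j : ℕ) else 0) =
      g (i : ℕ) - g ((i : ℕ) - 1) := by
    by_cases hi : 0 < (i : ℕ)
    · rw [sum_eq_single ⟨(i : ℕ) - 1, by omega⟩]
      · rw [if_pos (Nat.sub_add_cancel hi)]
        simp [Nat.cast_sub hi]
      · intro j _ hj
        refine if_neg fun h => hj (Fin.ext ?_)
        simp only
        omega
      · simp
    · have : (i : ℕ) = 0 := by omega
      simp [this, h0]
  rw [hup, hdown]
  ring

/-- The numbers `2 - 2 cos (kπ/n)` with `k < n` are Laplacian eigenvalues of the path. -/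
theorem exists_lapEigenvalue_pathGraph_eq {k : ℕ} (hk : k < n) :
    ∃ j < n, (pathGraph n).lapEigenvalue (j + 1) = 2 - 2 * Real.cos (k * Real.pi / n) := by
  have hn0 : (0 : ℝ) < n := by exact_mod_cast (by omega : 0 < n)
  set φ : ℝ := k * Real.pi / (2 * n) with hφ
  have h2φ : k * Real.pi / n = 2 * φ := by rw [hφ]; field_simp
  -- This cosine is symmetric about `-1/2` and `n - 1/2`, which yields both reflecting boundary
  -- conditions.
  let g : ℝ → ℝ := fun t => Real.cos ((2 * t + 1) * φ)
  have h0 : g (-1) = g 0 := by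
    simp only [g]
    rw [← Real.cos_neg]
    ring_nf
  have hn : g (n - 1) = g n := by
    have hnφ : 2 * n * φ = k * Real.pi := by rw [hφ]; field_simp
    simp only [g]
    rw [show (2 * ((n : ℝ) - 1) + 1) * φ = k * Real.pi - φ by rw [← hnφ]; ring,
      show (2 * (n : ℝ) + 1) * φ = k * Real.pi + φ by rw [← hnφ]; ring,
      Real.cos_add, Real.cos_sub, Real.sin_nat_mul_pi]
    ring
  have hL : (pathGraph n).lapMatrix ℝ *ᵥ (fun j => g (j : ℕ)) =
      (2 - 2 * Real.cos (k * Real.pi / n)) • fun j : Fin n => g (j : ℕ) := by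
    ext i
    rw [lapMatrix_pathGraph_mulVec_apply g h0 hn, Pi.smul_apply, smul_eq_mul, h2φ]
    simp only [g]
    rw [show (2 * ((i : ℕ) + 1 : ℝ) + 1) * φ = (2 * (i : ℕ) + 1) * φ + 2 * φ by ring,
      show (2 * ((i : ℕ) - 1 : ℝ) + 1) * φ = (2 * (i : ℕ) + 1) * φ - 2 * φ by ring,
      Real.cos_add, Real.cos_sub]
    ring
  have hne : (fun j : Fin n => g (j : ℕ)) ≠ 0 := fun h => by
    have h1 : g 0 = 0 := by simpa using congrFun h ⟨0, by omega⟩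
    have hφ0 : 0 ≤ φ := by positivity
    have hφ1 : φ < Real.pi / 2 := by
      rw [hφ, div_lt_div_iff₀ (by positivity) (by norm_num)]
      have : (k : ℝ) < n := by exact_mod_cast hk
      nlinarith [Real.pi_pos]
    have hpos : 0 < Real.cos φ := Real.cos_pos_of_mem_Ioo ⟨by linarith [Real.pi_pos], hφ1⟩
    simp only [g, mul_zero, zero_add, one_mul] at h1
    exact hpos.ne' h1
  simpa using (pathGraph n).exists_lapEigenvalue_eq hne hL

theorem two_add_two_cos_le_lapEigenvalue_pathGraph_one (hn : 1 ≤ n) :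
    2 + 2 * Real.cos (Real.pi / n) ≤ (pathGraph n).lapEigenvalue 1 := by
  obtain ⟨j, hj, h⟩ := exists_lapEigenvalue_pathGraph_eq (n := n) (k := n - 1) (by omega)
  have hn0 : (n : ℝ) ≠ 0 := by positivity
  have hle := (pathGraph n).lapEigenvalue_antitone (j := 0) (k := j) (by omega) (by simpa using hj)
  have harg : ((n - 1 : ℕ) : ℝ) * Real.pi / n = Real.pi - Real.pi / n := by
    rw [Nat.cast_sub hn]
    field_simp
    simp
  rw [h, harg, Real.cos_pi_sub] at hle
  simpa using hle

theorem lapEigenvalue_pathGraph_card_sub_one_le (hn : 2 ≤ n) :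
    (pathGraph n).lapEigenvalue (n - 1) ≤ 2 - 2 * Real.cos (Real.pi / n) := by
  obtain ⟨j, hj, h⟩ := exists_lapEigenvalue_pathGraph_eq (n := n) (k := 1) (by omega)
  rw [Nat.cast_one, one_mul] at h
  have : Nonempty (Fin n) := ⟨⟨0, by omega⟩⟩
  -- Positivity keeps this eigenvalue away from the last position, which holds 0, so `μ_{n-1}` is at
  -- most it.
  have hpos : 0 < 2 - 2 * Real.cos (Real.pi / n) := by
    have hn1 : (1 : ℝ) < n := by exact_mod_cast (by omega : 1 < n)
    have hlt : Real.cos (Real.pi / n) < Real.cos 0 :=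
      Real.cos_lt_cos_of_nonneg_of_le_pi le_rfl (div_le_self Real.pi_pos.le hn1.le)
        (by have := Real.pi_pos; positivity)
    rw [Real.cos_zero] at hlt
    linarith
  have hlast := lapEigenvalue_card (G := pathGraph n)
  rw [Fintype.card_fin] at hlast
  have hjn : j + 1 ≠ n := by
    rintro rfl
    rw [hlast] at h
    exact hpos.ne h
  have hle := (pathGraph n).lapEigenvalue_antitone (j := j) (k := n - 2) (by omega)
    (by rw [Fintype.card_fin]; omega)
  rwa [h, show n - 2 + 1 = n - 1 by omega] at hle

/-- A numerical lower bound for the Laplacian spectral ratio `cot² (π/(2n))` of the path. -/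
theorem le_lapSpectralRatio_pathGraph (hn : 6 ≤ n) :
    400 * (n : ℝ) ^ 2 / (121 * Real.pi ^ 2) ≤ (pathGraph n).lapSpectralRatio := by
  have hn6 : (6 : ℝ) ≤ n := by exact_mod_cast hn
  have hconn : (pathGraph n).Connected := by
    obtain ⟨m, rfl⟩ : ∃ m, n = m + 1 := ⟨n - 1, by omega⟩
    exact pathGraph_connected m
  have hpos := hconn.lapEigenvalue_card_sub_one_pos (by rw [Fintype.card_fin]; omega)
  have htop := two_add_two_cos_le_lapEigenvalue_pathGraph_one (n := n) (by omega)
  have hbot := lapEigenvalue_pathGraph_card_sub_one_le (n := n) (by omega)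
  have hcos := Real.one_sub_sq_div_two_le_cos (x := Real.pi / n)
  rw [lapSpectralRatio]
  rw [Fintype.card_fin] at hpos ⊢
  rw [le_div_iff₀ hpos]
  have hπ : (0 : ℝ) < Real.pi ^ 2 := by have := Real.pi_pos; positivity
  have hπ10 : Real.pi ^ 2 < 10 := by nlinarith [Real.pi_lt_d2, Real.pi_pos]
  rw [div_pow] at hcos
  set q : ℝ := Real.pi ^ 2 / n ^ 2 with hq
  have hn2 : (36 : ℝ) ≤ n ^ 2 := by nlinarith
  have hq1 : q ≤ 10 / 36 := by
    rw [hq]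
    exact div_le_div₀ (by norm_num) hπ10.le (by norm_num) hn2
  calc 400 * (n : ℝ) ^ 2 / (121 * Real.pi ^ 2) * (pathGraph n).lapEigenvalue (n - 1)
      ≤ 400 * (n : ℝ) ^ 2 / (121 * Real.pi ^ 2) * q :=
        mul_le_mul_of_nonneg_left (by linarith) (by positivity)
    _ = 400 / 121 := by
        rw [hq]
        field_simp
    -- Here `μ_1 ≥ 4 - q ≥ 4 - 10/36 > 400/121`; this is where `n ≥ 6` enters.
    _ ≤ (pathGraph n).lapEigenvalue 1 := by linarith

end Path

end SimpleGraph

/-! ### Comparison of the tree with the path -/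

theorem theorem4p4 {V : Type*} [Fintype V] [DecidableEq V] (n : ℕ) (hn : 6 ≤ n)
    (hV : Fintype.card V = n) (T : SimpleGraph V) [DecidableRel T.Adj]
    [DecidableRel (SimpleGraph.pathGraph n).Adj] (hT : T.IsTree)
    (h : (T.maxDegree : ℝ) + 2 * √((T.maxDegree : ℝ) + 1) ≤
      1600 * (n : ℝ) / (121 * (T.diam : ℝ) * Real.pi ^ 2)) :
    T.lapSpectralRatio < (SimpleGraph.pathGraph n).lapSpectralRatio := by
  classical
  subst hV
  have hn0 : (0 : ℝ) < Fintype.card V := by exact_mod_cast (by omega : 0 < Fintype.card V)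
  have : Nontrivial V := Fintype.one_lt_card_iff_nontrivial.mp (by omega)
  have hdiam : 0 < (T.diam : ℝ) := by
    have := SimpleGraph.diam_ne_zero_of_ediam_ne_top
      (SimpleGraph.connected_iff_ediam_ne_top.mp hT.connected)
    positivity
  have hΔ : 1 ≤ T.maxDegree := by
    have v := Classical.arbitrary V
    exact (hT.connected.preconnected.degree_pos_of_nontrivial v).trans_le (T.degree_le_maxDegree v)
  have hpos := hT.connected.lapEigenvalue_card_sub_one_pos (by omega)
  have htop := hT.lapEigenvalue_one_le hΔ
  have hbot := hT.four_le_lapEigenvalue_mul (by omega)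
  -- The strictness of the conclusion comes from this gap.
  have hsqrt : √(T.maxDegree : ℝ) < √((T.maxDegree : ℝ) + 1) :=
    Real.sqrt_lt_sqrt (Nat.cast_nonneg _) (lt_add_one _)
  refine lt_of_lt_of_le ?_ (SimpleGraph.le_lapSpectralRatio_pathGraph hn)
  rw [SimpleGraph.lapSpectralRatio, div_lt_iff₀ hpos]
  set lam := T.lapEigenvalue (Fintype.card V - 1)
  have hπ := Real.pi_pos
  calc T.lapEigenvalue 1 < T.maxDegree + 2 * √((T.maxDegree : ℝ) + 1) := by linarith
    _ ≤ 1600 * (Fintype.card V : ℝ) / (121 * (T.diam : ℝ) * Real.pi ^ 2) := h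
    _ = 400 * (Fintype.card V : ℝ) ^ 2 / (121 * Real.pi ^ 2) *
        (4 / (Fintype.card V * T.diam)) := by
        field_simp
        norm_num
    _ ≤ 400 * (Fintype.card V : ℝ) ^ 2 / (121 * Real.pi ^ 2) * lam := by
        refine mul_le_mul_of_nonneg_left ?_ (by positivity)
        rwa [div_le_iff₀ (by positivity)]
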